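/- Let $V$ be a finite set and let $C\in\mathbb{R}^{V\times V}$ be a diagonal positive definite matrix (for instance $C=2I$). A \emph{DAG} on $V$ is a directed graph $\mathcal{G}=(V,E)$ that contains every self-loop $i\to i$ and has no directed cycle of length greater than one; a \emph{polytree} is a DAG whose skeleton (the undirected graph obtained by dropping self-loops and forgetting edge directions) is a tree. A real matrix is \emph{stable} if all its eigenvalues have strictly negative real part. The \emph{Lyapunov model} of $\mathcal{G}$ is the set $\mathcal{M}_{\mathcal{G},C}$ of all positive definite matrices $\Sigma\in\mathbb{R}^{V\times V}$ for which there is a stable matrix $M$ with $m_{ji}=0$ whenever $i\to j\notin E$ and $M\Sigma+\Sigma M^{T}+C=0$. A DAG $\mathcal{G}$ on $V$ is \emph{structurally identifiable within the class of Lyapunov DAG models} if the only DAG $\mathcal{H}$ on $V$ with $\mathcal{M}_{\mathcal{H},C}=\mathcal{M}_{\mathcal{G},C}$ is $\mathcal{G}$ itself. Write $\mathrm{pa}(i)$, $\mathrm{ch}(i)$ for the parents and children of $i$ (ignoring self-loops) and $\mathrm{ne}(i)=\mathrm{pa}(i)\cup\mathrm{ch}(i)$. An edge $i\to j$ with $i\neq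 j$ of a DAG $\mathcal{G}$ is \emph{super-covered} if 1. $\mathrm{ch}(i)=\mathrm{ch}(j)\cup\{j\}$ and $\mathrm{pa}(i)\cup\{i\}=\mathrm{pa}(j)$; 2. $k\to l\in E$ for all $k\in\mathrm{pa}(j)$ and $l\in\mathrm{ch}(i)$; 3. every $k\in V\setminus\{i,j\}$ lies in $\mathrm{ne}(i)\cap\mathrm{ne}(j)$ or is marginally independent of $\{i,j\}$ in the model, i.e. $\sigma_{ki}=\sigma_{kj}=0$ for all $\Sigma\in\mathcal{M}_{\mathcal{G},C}$. \textbf{Corollary.} Let $\mathcal{T}$ be a polytree on $V$ with $|V|\ge 3$. Then $\mathcal{T}$ is structurally identifiable within the class of Lyapunov DAG models. Moreover, $\mathcal{T}$ contains no super-covered edge. -/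

import Mathlib

namespace LyapunovModel

open Matrix

variable {V : Type*}

/-- A real square matrix is stable if all its (complex) eigenvalues have strictly negative
real part. -/
def IsStable [Fintype V] [DecidableEq V] (M : Matrix V V ℝ) : Prop :=
  ∀ z ∈ spectrum ℂ (M.map (algebraMap ℝ ℂ)), z.re < 0

/-- The space of drift matrices supported on the edges of `G`: the entry in row `j` and column
`i` may be nonzero only if `i → j` is an edge. -/
def driftSpace (G : Digraph V) : Set (Matrix V V ℝ) :=
  {M | ∀ i j, ¬ G.Adj i j → M j i = 0}

/-- The graphical continuous Lyapunov model of `G` with volatility matrix `C`. A centered normal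
distribution is represented by its covariance matrix `S`. -/
def model [Fintype V] [DecidableEq V] (C : Matrix V V ℝ) (G : Digraph V) :
    Set (Matrix V V ℝ) :=
  {S | S.PosDef ∧ ∃ M ∈ driftSpace G, IsStable M ∧ M * S + S * Mᵀ + C = 0}

/-- `G₁` and `G₂` are model equivalent (for the volatility matrix `C`). -/
def ModelEquivalent [Fintype V] [DecidableEq V] (C : Matrix V V ℝ) (G₁ G₂ : Digraph V) : Prop :=
  model C G₁ = model C G₂

/-- `G` belongs to the class `L`, and its model equivalence class meets `L` in exactly one
element. -/
def StructurallyIdentifiable [Fintype V] [DecidableEq V] (C : Matrix V V ℝ)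
    (L : Set (Digraph V)) (G : Digraph V) : Prop :=
  G ∈ L ∧ ∃! H : Digraph V, H ∈ L ∧ ModelEquivalent C G H

/-- Parents of `i`; self-loops are ignored. -/
def parents (G : Digraph V) (i : V) : Set V := {k | k ≠ i ∧ G.Adj k i}

/-- Children of `i`; self-loops are ignored. -/
def children (G : Digraph V) (i : V) : Set V := {k | k ≠ i ∧ G.Adj i k}

/-- Neighbors of `i`; self-loops are ignored. -/
def neighbors (G : Digraph V) (i : V) : Set V := parents G i ∪ children G i

/-- The DAGs on the vertex set `V`: directed graphs that contain every self-loop and have no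
directed cycle of length greater than one (that is, no nonempty closed directed walk along
edges which are not self-loops). -/
def dags (V : Type*) : Set (Digraph V) :=
  {G | (∀ i, G.Adj i i) ∧ ∀ i, ¬ Relation.TransGen (fun a b => a ≠ b ∧ G.Adj a b) i i}

/-- A polytree: a DAG whose skeleton is a tree. -/
def IsPolytree (G : Digraph V) : Prop :=
  G ∈ dags V ∧ G.toSimpleGraphInclusive.IsTree

/-- The marginal independence of `k` and `{i, j}` holds in the model of `G`. For jointly normal
variables this is the vanishing of the two covariances. -/
def MarginallyIndependent [Fintype V] [DecidableEq V] (C : Matrix V V ℝ) (G : Digraph V)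
    (k i j : V) : Prop :=
  ∀ S ∈ model C G, S k i = 0 ∧ S k j = 0

/-- The edge `i → j` of `G` is super-covered. -/
structure IsSuperCovered [Fintype V] [DecidableEq V] (C : Matrix V V ℝ) (G : Digraph V)
    (i j : V) : Prop where
  ne : i ≠ j
  adj : G.Adj i j
  children_eq : children G i = children G j ∪ {j}
  parents_eq : parents G i ∪ {i} = parents G j
  complete : ∀ k ∈ parents G j, ∀ l ∈ children G i, G.Adj k l
  others : ∀ k, k ≠ i → k ≠ j →
    k ∈ neighbors G i ∩ neighbors G j ∨ MarginallyIndependent C G k i j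

end LyapunovModel

/-!
Conjugating by a diagonal matrix reduces to `C = 1`. If `N` is a nilpotent drift supported on the
edges, then `N - 1/2` is stable and its covariance matrix is a polynomial in `N` and `Nᵀ`. With
unit weights on one edge, on a chain `a → b → c`, or on a collider `a → b ← c`, and the identity
elsewhere, this covariance matrix satisfies a Lyapunov equation whose entries on `{a, b, c}` involve
only drift coefficients among these vertices. So the edge witness shows that the model determines
the skeleton, and the chain and collider witnesses show that it determines the direction of `a → b`
as soon as some vertex is adjacent to exactly one of `a` and `b`. The same vertex, being correlated
with an endpoint, keeps `a → b` from being super-covered. In a tree on at least three vertices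
such a vertex exists for every edge, since a connected graph reaches beyond `{a, b}` and a common
neighbor of `a` and `b` would close a triangle.
-/

namespace LyapunovModel

open Matrix

variable {V : Type*}

section DriftSpace

variable {G : Digraph V} {M N : Matrix V V ℝ}

lemma single_mem_driftSpace [DecidableEq V] {a b : V} (h : G.Adj a b) :
    single b a (1 : ℝ) ∈ driftSpace G := by
  intro i j hij
  exact single_apply_of_ne _ _ _ _ _ (by rintro ⟨rfl, rfl⟩; exact hij h)

lemma add_mem_driftSpace (hM : M ∈ driftSpace G) (hN : N ∈ driftSpace G) :
    M + N ∈ driftSpace G := fun i j hij => by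
  rw [Matrix.add_apply, hM i j hij, hN i j hij, add_zero]

end DriftSpace

section Rescaling

variable [Fintype V] [DecidableEq V] {C S : Matrix V V ℝ} {G H : Digraph V} {d : V → ℝ}

lemma diagonal_mul_mul_diagonal_mem_model (hd : ∀ i, d i ≠ 0) (hS : S ∈ model C G) :
    diagonal d * S * diagonal d ∈ model (diagonal d * C * diagonal d) G := by
  obtain ⟨hS, M, hM, hstable, hMS⟩ := hS
  have hmul : diagonal d * diagonal d⁻¹ = 1 := by
    simp [diagonal_mul_diagonal, hd, ← diagonal_one]
  let D : (Matrix V V ℝ)ˣ := ⟨diagonal d, diagonal d⁻¹, hmul, mul_eq_one_comm.1 hmul⟩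
  refine ⟨?_, (D * M * D⁻¹ : Matrix V V ℝ), fun i j hij => ?_, ?_, ?_⟩
  · simpa [star_eq_conjTranspose, D] using
      (IsUnit.posDef_star_right_conjugate_iff (x := S) D.isUnit).2 hS
  · simp [D, diagonal_mul, mul_diagonal, hM i j hij]
  · let Dc : (Matrix V V ℂ)ˣ := Units.map (algebraMap ℝ ℂ).mapMatrix.toMonoidHom D
    have hconj : (D * M * D⁻¹ : Matrix V V ℝ).map (algebraMap ℝ ℂ) =
        (Dc : Matrix V V ℂ) * M.map (algebraMap ℝ ℂ) * ((Dc⁻¹ : (Matrix V V ℂ)ˣ) : Matrix V V ℂ) :=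
      (Matrix.map_mul ..).trans (congrArg (· * _) (Matrix.map_mul ..))
    rwa [IsStable, hconj, spectrum.units_conjugate]
  · have hD : (D : Matrix V V ℝ)ᵀ = D := diagonal_transpose d
    have hDinv : (↑D⁻¹ : Matrix V V ℝ)ᵀ = ↑D⁻¹ := diagonal_transpose _
    calc (D * M * D⁻¹ : Matrix V V ℝ) * (D * S * D) + D * S * D * (D * M * D⁻¹ : Matrix V V ℝ)ᵀ
          + D * C * D
      _ = D * (M * S + S * Mᵀ + C) * D := by
        simp only [transpose_mul, hD, hDinv, Matrix.mul_assoc, Units.inv_mul_cancel_left,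
          Units.mul_inv_cancel_left, Matrix.mul_add, Matrix.add_mul]
      _ = 0 := by rw [hMS, Matrix.mul_zero, Matrix.zero_mul]

lemma diagonal_mul_mul_diagonal_mem_model_iff (hd : ∀ i, d i ≠ 0) :
    diagonal d * S * diagonal d ∈ model (diagonal d * C * diagonal d) G ↔ S ∈ model C G := by
  refine ⟨fun h => ?_, diagonal_mul_mul_diagonal_mem_model hd⟩
  have hcancel (A : Matrix V V ℝ) :
      diagonal d⁻¹ * (diagonal d * A * diagonal d) * diagonal d⁻¹ = A := by
    ext i j
    have hi := hd i
    have hj := hd j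
    simp only [mul_diagonal, diagonal_mul, Pi.inv_apply]
    field_simp
  simpa only [hcancel] using
    diagonal_mul_mul_diagonal_mem_model (d := d⁻¹) (fun i => inv_ne_zero (hd i)) h

lemma exists_diagonal_mem_model_iff (hC : C.PosDef) (hdiag : C.IsDiag) :
    ∃ d : V → ℝ, (∀ i, d i ≠ 0) ∧
      ∀ G S, diagonal d * S * diagonal d ∈ model C G ↔ S ∈ model 1 G := by
  have hd (i : V) : √(C i i) ≠ 0 := (Real.sqrt_pos.2 hC.diag_pos).ne'
  refine ⟨fun i => √(C i i), hd, fun G S => ?_⟩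
  have hscale : diagonal (fun i => √(C i i)) * 1 * diagonal (fun i => √(C i i)) = C := by
    simp only [Matrix.mul_one, diagonal_mul_diagonal, Real.mul_self_sqrt hC.diag_pos.le]
    exact hdiag.diagonal_diag
  simpa only [hscale] using
    diagonal_mul_mul_diagonal_mem_model_iff (C := 1) (S := S) (G := G) hd

lemma model_one_subset_of_subset (hC : C.PosDef) (hdiag : C.IsDiag)
    (h : model C G ⊆ model C H) : model 1 G ⊆ model 1 H := by
  obtain ⟨d, -, hd⟩ := exists_diagonal_mem_model_iff hC hdiag
  exact fun S hS => (hd H S).1 (h ((hd G S).2 hS))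

end Rescaling

section NilpotentDrift

variable [Fintype V] [DecidableEq V] {N : Matrix V V ℝ} {G : Digraph V}

lemma isStable_sub_smul_one (hN : IsNilpotent N) {r : ℝ} (hr : 0 < r) :
    IsStable (N - r • 1) := by
  intro z hz
  by_contra! hre
  have hzr : z + r ≠ 0 := fun h => by
    have := congrArg Complex.re h
    simp only [Complex.add_re, Complex.ofReal_re, Complex.zero_re] at this
    linarith
  have hsub : algebraMap ℂ (Matrix V V ℂ) z - (N - r • 1).map (algebraMap ℝ ℂ) =
      algebraMap ℂ _ (z + r) + (algebraMap ℝ ℂ).mapMatrix (-N) := by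
    ext i j
    by_cases hij : i = j
    · simp only [hij, Complex.coe_algebraMap, Complex.ofReal_sub, Complex.ofReal_neg, map_add,
        map_apply, algebraMap_matrix_apply, Algebra.algebraMap_self, RingHom.id_apply,
        RingHom.mapMatrix_apply, Matrix.add_apply, Matrix.sub_apply, Matrix.neg_apply,
        Matrix.smul_apply, one_apply_eq, smul_eq_mul, mul_one, ↓reduceIte]
      ring
    · simp [hij, algebraMap_matrix_apply]
  refine hz ?_
  rw [spectrum.mem_resolventSet_iff, hsub]
  exact (hN.neg.map _).isUnit_add_left_of_commute ((IsUnit.mk0 _ hzr).map _)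
    (Algebra.commutes _ _).symm

/-- The solution `Σ` of the Lyapunov equation with drift `N - 1/2` and volatility `1`, for a
matrix `N` with `N ^ 3 = 0`. It is `∫ e^{-t} e^{tN} e^{tNᵀ} dt` over `t ≥ 0`, that is, the sum of
`(j + k).choose j • N ^ j * Nᵀ ^ k` over `j, k ≤ 2`; the Cholesky factorization of the Pascal
matrix turns it into a sum of Gram matrices. -/
def nilpotentCov (N : Matrix V V ℝ) : Matrix V V ℝ :=
  (1 + N + N ^ 2) * (1 + N + N ^ 2)ᵀ + (N + 2 • N ^ 2) * (N + 2 • N ^ 2)ᵀ + N ^ 2 * (N ^ 2)ᵀ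

lemma nilpotentCov_of_sq_eq_zero (hN : N ^ 2 = 0) :
    nilpotentCov N = 1 + N + Nᵀ + 2 • (N * Nᵀ) := by
  simp only [nilpotentCov, hN, transpose_add, transpose_one, smul_zero, add_zero,
    Matrix.zero_mul]
  noncomm_ring

lemma posDef_nilpotentCov (hN : N ^ 3 = 0) : (nilpotentCov N).PosDef := by
  have hunit : IsUnit (1 + N + N ^ 2) := by
    refine IsUnit.of_mul_eq_one (1 - N) ?_
    linear_combination (norm := noncomm_ring) - hN
  have hpos := (IsUnit.posDef_star_right_conjugate_iff (x := 1) hunit).2 PosDef.one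
  rw [Matrix.mul_one, star_eq_conjTranspose] at hpos
  exact (hpos.add_posSemidef (posSemidef_self_mul_conjTranspose _)).add_posSemidef
    (posSemidef_self_mul_conjTranspose _)

lemma lyapunov_nilpotentCov (hN : N ^ 3 = 0) :
    (N - (1 / 2 : ℝ) • 1) * nilpotentCov N + nilpotentCov N * (N - (1 / 2 : ℝ) • 1)ᵀ + 1 = 0 := by
  have hNt : Nᵀ ^ 3 = 0 := by rw [← transpose_pow, hN, transpose_zero]
  calc (N - (1 / 2 : ℝ) • 1) * nilpotentCov N + nilpotentCov N * (N - (1 / 2 : ℝ) • 1)ᵀ + 1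
    _ = N * nilpotentCov N + nilpotentCov N * Nᵀ - nilpotentCov N + 1 := by
      simp only [transpose_sub, transpose_smul, transpose_one, Matrix.sub_mul, Matrix.mul_sub,
        Matrix.smul_mul, Matrix.mul_smul, Matrix.one_mul, Matrix.mul_one]
      module
    _ = 0 := by
      simp only [nilpotentCov, transpose_add, transpose_smul, transpose_pow, transpose_one]
      linear_combination (norm := noncomm_ring)
        hN * ((1 + Nᵀ + Nᵀ ^ 2) + 2 • (Nᵀ + 2 • Nᵀ ^ 2) + Nᵀ ^ 2) +
        ((1 + N + N ^ 2) + 2 • (N + 2 • N ^ 2) + N ^ 2) * hNt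

lemma nilpotentCov_mem_model (hG : ∀ i, G.Adj i i) (hNG : N ∈ driftSpace G) (hN : N ^ 3 = 0) :
    nilpotentCov N ∈ model 1 G := by
  refine ⟨posDef_nilpotentCov hN, N - (1 / 2 : ℝ) • 1, fun i j hij => ?_,
    isStable_sub_smul_one ⟨3, hN⟩ one_half_pos, lyapunov_nilpotentCov hN⟩
  have hji : j ≠ i := fun h => hij (h ▸ hG i)
  simp [hNG i j hij, hji]

end NilpotentDrift

section Witnesses

variable [Fintype V] [DecidableEq V] {G H : Digraph V} {a b c : V}

lemma exists_mem_driftSpace_mul_apply_add {C S : Matrix V V ℝ} (hS : S ∈ model C G) :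
    ∃ M ∈ driftSpace G, ∀ i j, (M * S) i j + (M * S) j i + C i j = 0 := by
  obtain ⟨hS, M, hM, -, h⟩ := hS
  refine ⟨M, hM, fun i j => ?_⟩
  have hSt : Sᵀ = S := hS.isHermitian
  have hT : S * Mᵀ = (M * S)ᵀ := by rw [transpose_mul, hSt]
  rw [hT] at h
  exact congrFun₂ h i j

lemma exists_mem_model_of_edge (hG : ∀ i, G.Adj i i) (hab : a ≠ b) (h : G.Adj a b) :
    ∃ S ∈ model 1 G, ∀ (M : Matrix V V ℝ) i,
      (M * S) i a = M i a + M i b ∧ (M * S) i b = M i a + 3 * M i b := by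
  have hsq : single b a (1 : ℝ) ^ 2 = 0 := by
    rw [sq, single_mul_single_of_ne _ _ _ _ hab]
  refine ⟨nilpotentCov (single b a 1), nilpotentCov_mem_model hG (single_mem_driftSpace h)
    (by rw [pow_succ, hsq, zero_mul]), fun M i => ?_⟩
  constructor
  all_goals
    simp only [nilpotentCov_of_sq_eq_zero hsq, transpose_single, single_mul_single_same,
      Matrix.mul_add, Matrix.mul_one, Matrix.mul_smul, Matrix.add_apply, Matrix.smul_apply,
      mul_single_apply_same, mul_single_apply_of_ne, ne_eq, not_false_eq_true, hab, hab.symm]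
    ring

lemma exists_mem_model_of_collider (hG : ∀ i, G.Adj i i) (hab : a ≠ b) (hbc : b ≠ c) (hac : a ≠ c)
    (h : G.Adj a b) (h' : G.Adj c b) :
    ∃ S ∈ model 1 G, ∀ (M : Matrix V V ℝ) i, (M * S) i a = M i a + M i b ∧
      (M * S) i b = M i a + 5 * M i b + M i c ∧ (M * S) i c = M i b + M i c := by
  have hsq : (single b a (1 : ℝ) + single b c 1) ^ 2 = 0 := by
    simp [sq, Matrix.add_mul, Matrix.mul_add, hab, hbc.symm]
  refine ⟨nilpotentCov (single b a 1 + single b c 1), nilpotentCov_mem_model hG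
    (add_mem_driftSpace (single_mem_driftSpace h) (single_mem_driftSpace h'))
    (by rw [pow_succ, hsq, zero_mul]), fun M i => ?_⟩
  refine ⟨?_, ?_, ?_⟩
  all_goals
    simp only [nilpotentCov_of_sq_eq_zero hsq, transpose_add, transpose_single,
      single_mul_single_same, single_mul_single_of_ne, Matrix.add_mul, Matrix.mul_add,
      Matrix.mul_one, Matrix.mul_zero, Matrix.mul_smul, Matrix.add_apply, Matrix.zero_apply,
      Matrix.smul_apply, mul_single_apply_same, mul_single_apply_of_ne, ne_eq, not_false_eq_true,
      hab, hab.symm, hac, hac.symm, hbc, hbc.symm]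
    ring

lemma exists_mem_model_of_chain (hG : ∀ i, G.Adj i i) (hab : a ≠ b) (hbc : b ≠ c) (hac : a ≠ c)
    (h : G.Adj a b) (h' : G.Adj b c) :
    ∃ S ∈ model 1 G, ∀ (M : Matrix V V ℝ) i, (M * S) i a = M i a + M i b + M i c ∧
      (M * S) i b = M i a + 3 * M i b + 4 * M i c ∧
      (M * S) i c = M i a + 4 * M i b + 9 * M i c := by
  have hsq : (single b a (1 : ℝ) + single c b 1) ^ 2 = single c a 1 := by
    simp [sq, Matrix.add_mul, Matrix.mul_add, hab, hbc, hac]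
  refine ⟨nilpotentCov (single b a 1 + single c b 1), nilpotentCov_mem_model hG
    (add_mem_driftSpace (single_mem_driftSpace h) (single_mem_driftSpace h'))
    (by simp [pow_succ _ 2, hsq, Matrix.mul_add, hab, hac]), fun M i => ?_⟩
  refine ⟨?_, ?_, ?_⟩
  all_goals
    simp only [nilpotentCov, hsq, transpose_add, transpose_one, transpose_smul, transpose_single,
      single_mul_single_same, single_mul_single_of_ne, Matrix.add_mul, Matrix.mul_add,
      Matrix.one_mul, Matrix.mul_one, Matrix.mul_zero, Matrix.smul_mul, Matrix.mul_smul,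
      Matrix.add_apply, Matrix.zero_apply, Matrix.smul_apply, mul_single_apply_same,
      mul_single_apply_of_ne, ne_eq, not_false_eq_true, hab, hab.symm, hac, hac.symm, hbc, hbc.symm]
    ring

lemma adj_or_adj_of_model_subset (hG : ∀ i, G.Adj i i) (hmod : model 1 G ⊆ model 1 H)
    (hab : a ≠ b) (h : G.Adj a b) : H.Adj a b ∨ H.Adj b a := by
  by_contra! hH
  obtain ⟨S, hS, hcol⟩ := exists_mem_model_of_edge hG hab h
  obtain ⟨M, hM, hMS⟩ := exists_mem_driftSpace_mul_apply_add (hmod hS)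
  have hMab : M a b = 0 := hM _ _ hH.2
  have hMba : M b a = 0 := hM _ _ hH.1
  have haa := hMS a a
  have hbb := hMS b b
  have hab' := hMS a b
  simp only [hcol, hMab, hMba, one_apply_eq, one_apply_ne hab] at haa hbb hab'
  linarith

lemma adj_of_model_subset_of_path (hG : ∀ i, G.Adj i i) (hmod : model 1 G ⊆ model 1 H)
    (hab : a ≠ b) (hbc : b ≠ c) (hac : a ≠ c) (h : G.Adj a b) (h' : G.Adj b c ∨ G.Adj c b)
    (hHac : ¬ H.Adj a c) (hHca : ¬ H.Adj c a) (hHbc : ¬ (H.Adj b c ∧ H.Adj c b)) :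
    H.Adj a b := by
  by_contra hHab
  obtain ⟨S, hS, hcol⟩ | ⟨S, hS, hcol⟩ := h'.imp (exists_mem_model_of_chain hG hab hbc hac h)
    (exists_mem_model_of_collider hG hab hbc hac h)
  all_goals
    obtain ⟨M, hM, hMS⟩ := exists_mem_driftSpace_mul_apply_add (hmod hS)
    have hMba : M b a = 0 := hM _ _ hHab
    have hMca : M c a = 0 := hM _ _ hHac
    have hMac : M a c = 0 := hM _ _ hHca
    have hMbc : M b c = 0 ∨ M c b = 0 := (not_and_or.1 hHbc).symm.imp (hM _ _) (hM _ _)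
    have haa := hMS a a
    have hbb := hMS b b
    have hcc := hMS c c
    have hab' := hMS a b
    have hac' := hMS a c
    have hbc' := hMS b c
    simp only [hcol, hMba, hMca, hMac, one_apply_eq, one_apply_ne hab, one_apply_ne hac,
      one_apply_ne hbc] at haa hbb hcc hab' hac' hbc'
    -- An inconsistent linear system: six equations, five drift coefficients left.
    rcases hMbc with hMbc | hMcb <;> linarith

end Witnesses

section Orientation

variable {G H : Digraph V} {a b c : V}

lemma mem_neighbors_iff : b ∈ neighbors G a ↔ b ≠ a ∧ (G.Adj b a ∨ G.Adj a b) :=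
  and_or_left.symm

lemma mem_neighbors_comm : b ∈ neighbors G a ↔ a ∈ neighbors G b := by
  simp only [mem_neighbors_iff, ne_comm, or_comm]

lemma not_adj_of_mem_dags (hG : G ∈ dags V) (hab : a ≠ b) (h : G.Adj a b) : ¬ G.Adj b a :=
  fun h' => hG.2 a (.tail (.single ⟨hab, h⟩) ⟨hab.symm, h'⟩)

lemma exists_xor_mem_neighbors (hab : b ∈ neighbors G a)
    (h : insert a (neighbors G a) ≠ insert b (neighbors G b)) :
    ∃ c, c ≠ a ∧ c ≠ b ∧ Xor (c ∈ neighbors G a) (c ∈ neighbors G b) := by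
  contrapose! h
  ext c
  rcases eq_or_ne c a with rfl | hca
  · simp [mem_neighbors_comm.1 hab]
  rcases eq_or_ne c b with rfl | hcb
  · simp [hab]
  · simpa [hca, hcb, not_xor] using h c hca hcb

variable [Fintype V] [DecidableEq V]

lemma neighbors_subset_of_model_subset (hG : ∀ i, G.Adj i i) (hmod : model 1 G ⊆ model 1 H)
    (a : V) : neighbors G a ⊆ neighbors H a := by
  intro b hb
  rw [mem_neighbors_iff] at hb ⊢
  refine ⟨hb.1, hb.2.elim (adj_or_adj_of_model_subset hG hmod hb.1) fun h => ?_⟩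
  exact (adj_or_adj_of_model_subset hG hmod hb.1.symm h).symm

lemma adj_of_model_eq_of_mem_neighbors (hG : G ∈ dags V) (hH : H ∈ dags V)
    (hmod : model 1 G = model 1 H) (hab : a ≠ b) (h : G.Adj a b) (hca : c ≠ a)
    (hcb : c ∈ neighbors G b) (hc : c ∉ neighbors G a) : H.Adj a b := by
  have hcH : c ∉ neighbors H a := fun hcH =>
    hc (neighbors_subset_of_model_subset hH.1 hmod.ge a hcH)
  simp only [mem_neighbors_iff, hca, ne_eq, not_false_eq_true, true_and, not_or] at hcH
  obtain ⟨hcb, hcb'⟩ := mem_neighbors_iff.1 hcb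
  exact adj_of_model_subset_of_path hG.1 hmod.le hab hcb.symm hca.symm h hcb'.symm hcH.2 hcH.1
    fun hbc => not_adj_of_mem_dags hH hcb.symm hbc.1 hbc.2

lemma adj_of_model_eq (hG : G ∈ dags V) (hH : H ∈ dags V) (hmod : model 1 G = model 1 H)
    (hab : a ≠ b) (h : G.Adj a b)
    (htwin : insert a (neighbors G a) ≠ insert b (neighbors G b)) : H.Adj a b := by
  obtain ⟨c, hca, hcb, ⟨hc, hc'⟩ | ⟨hc, hc'⟩⟩ :=
    exists_xor_mem_neighbors (mem_neighbors_iff.2 ⟨hab.symm, .inr h⟩) htwin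
  · have hnbr : neighbors G = neighbors H := funext fun i =>
      (neighbors_subset_of_model_subset hG.1 hmod.le i).antisymm
        (neighbors_subset_of_model_subset hH.1 hmod.ge i)
    by_contra hHab
    have hHba : H.Adj b a := (adj_or_adj_of_model_subset hG.1 hmod.le hab h).resolve_left hHab
    rw [hnbr] at hc hc'
    exact not_adj_of_mem_dags hG hab h
      (adj_of_model_eq_of_mem_neighbors hH hG hmod.symm hab.symm hHba hcb hc hc')
  · exact adj_of_model_eq_of_mem_neighbors hG hH hmod hab h hca hc hc'

lemma eq_of_model_one_eq (hG : G ∈ dags V) (hH : H ∈ dags V) (hmod : model 1 G = model 1 H)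
    (htwin : ∀ a b, a ≠ b → G.Adj a b → insert a (neighbors G a) ≠ insert b (neighbors G b)) :
    G = H := by
  have hGH (a b : V) (hab : a ≠ b) (h : G.Adj a b) : H.Adj a b :=
    adj_of_model_eq hG hH hmod hab h (htwin a b hab h)
  ext a b
  rcases eq_or_ne a b with rfl | hab
  · exact iff_of_true (hG.1 a) (hH.1 a)
  · refine ⟨hGH a b hab, fun h => ?_⟩
    refine (adj_or_adj_of_model_subset hH.1 hmod.ge hab h).resolve_right fun h' => ?_
    exact not_adj_of_mem_dags hH hab h (hGH b a hab.symm h')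

end Orientation

section SuperCovered

variable [Fintype V] [DecidableEq V] {C : Matrix V V ℝ} {G : Digraph V} {a b : V}

lemma exists_mem_model_apply_ne_zero (hC : C.PosDef) (hdiag : C.IsDiag)
    (hG : ∀ i, G.Adj i i) (hab : b ∈ neighbors G a) : ∃ S ∈ model C G, S b a ≠ 0 := by
  obtain ⟨d, hd, hmodel⟩ := exists_diagonal_mem_model_iff hC hdiag
  suffices ∃ S ∈ model 1 G, S b a ≠ 0 by
    obtain ⟨S, hS, hSba⟩ := this
    refine ⟨_, (hmodel G S).2 hS, ?_⟩
    simpa [hd] using hSba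
  rcases hab with ⟨hba, h⟩ | ⟨hba, h⟩
  · obtain ⟨S, hS, hcol⟩ := exists_mem_model_of_edge hG hba h
    have hSba : S b a = 1 := by simpa [hba] using (hcol 1 b).2
    exact ⟨S, hS, by simp [hSba]⟩
  · obtain ⟨S, hS, hcol⟩ := exists_mem_model_of_edge hG hba.symm h
    have hSba : S b a = 1 := by simpa [hba] using (hcol 1 b).1
    exact ⟨S, hS, by simp [hSba]⟩

lemma not_isSuperCovered (hC : C.PosDef) (hdiag : C.IsDiag) (hG : ∀ i, G.Adj i i)
    (htwin : insert a (neighbors G a) ≠ insert b (neighbors G b)) : ¬ IsSuperCovered C G a b := by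
  intro hab
  have hindep {c : V} (h : MarginallyIndependent C G c a b) :
      c ∉ neighbors G a ∧ c ∉ neighbors G b := by
    constructor <;> intro hc
    all_goals
      obtain ⟨S, hS, hSc⟩ := exists_mem_model_apply_ne_zero hC hdiag hG hc
    exacts [hSc (h S hS).1, hSc (h S hS).2]
  obtain ⟨c, hca, hcb, hc⟩ :=
    exists_xor_mem_neighbors (mem_neighbors_iff.2 ⟨hab.ne.symm, .inr hab.adj⟩) htwin
  rcases hab.others c hca hcb with hboth | hnone
  · exact (not_xor ..).2 (iff_of_true hboth.1 hboth.2) hc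
  · exact (not_xor ..).2 (iff_of_false (hindep hnone).1 (hindep hnone).2) hc

end SuperCovered

section Tree

lemma insert_neighborSet_ne {X : SimpleGraph V} (hconn : X.Connected) (hfree : X.CliqueFree 3)
    (hV : 3 ≤ ENat.card V) {a b : V} (hab : X.Adj a b) :
    insert a (X.neighborSet a) ≠ insert b (X.neighborSet b) := by
  classical
  intro htwin
  obtain ⟨c, hca, hcb⟩ := ENat.exists_ne_ne_of_three_le hV a b
  obtain ⟨p⟩ := hconn a c
  obtain ⟨e, -, hfst, hsnd⟩ := p.exists_boundary_dart {a, b} (by simp) (by simp [hca, hcb])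
  have hadj : e.snd ∈ X.neighborSet e.fst := e.adj
  have hiff := Set.ext_iff.1 htwin e.snd
  simp only [Set.mem_insert_iff, Set.mem_singleton_iff, not_or] at hfst hsnd hiff
  simp only [hsnd, false_or] at hiff
  have hboth : X.Adj a e.snd ∧ X.Adj b e.snd := by
    rcases hfst with h | h <;> rw [h] at hadj
    exacts [⟨hadj, hiff.1 hadj⟩, ⟨hiff.2 hadj, hadj⟩]
  exact hfree {a, b, e.snd} (SimpleGraph.is3Clique_triple_iff.2 ⟨hab, hboth.1, hboth.2⟩)

lemma neighborSet_toSimpleGraphInclusive (G : Digraph V) (a : V) :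
    G.toSimpleGraphInclusive.neighborSet a = neighbors G a := by
  ext b
  rw [mem_neighbors_iff, or_comm, ne_comm]
  rfl

lemma IsPolytree.insert_neighbors_ne {T : Digraph V} (hT : IsPolytree T) (hV : 3 ≤ ENat.card V)
    {a b : V} (hab : a ≠ b) (h : T.Adj a b) :
    insert a (neighbors T a) ≠ insert b (neighbors T b) := by
  simp only [← neighborSet_toSimpleGraphInclusive]
  exact insert_neighborSet_ne hT.2.connected (hT.2.isAcyclic.cliqueFree le_rfl) hV ⟨hab, .inl h⟩

end Tree

end LyapunovModel

theorem mainTheorem9_general {V : Type*} [Fintype V] [DecidableEq V]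
    (C : Matrix V V ℝ) (hC : C.PosDef) (hdiag : C.IsDiag)
    (T : Digraph V) (hT : T ∈ LyapunovModel.dags V)
    (htwin : ∀ i j, i ≠ j → T.Adj i j → insert i (LyapunovModel.neighbors T i) ≠
      insert j (LyapunovModel.neighbors T j)) :
    LyapunovModel.StructurallyIdentifiable C (LyapunovModel.dags V) T ∧
      ∀ i j : V, ¬ LyapunovModel.IsSuperCovered C T i j := by
  refine ⟨⟨hT, T, ⟨hT, rfl⟩, fun H ⟨hH, hTH⟩ => ?_⟩, fun i j hij => ?_⟩
  · have hmod : LyapunovModel.model 1 T = LyapunovModel.model 1 H :=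
      (LyapunovModel.model_one_subset_of_subset hC hdiag hTH.le).antisymm
        (LyapunovModel.model_one_subset_of_subset hC hdiag hTH.ge)
    exact (LyapunovModel.eq_of_model_one_eq hT hH hmod htwin).symm
  · exact LyapunovModel.not_isSuperCovered hC hdiag hT.1 (htwin i j hij.ne hij.adj) hij

theorem mainTheorem9 {V : Type*} [Fintype V] [DecidableEq V] (hV : 3 ≤ Fintype.card V)
    (C : Matrix V V ℝ) (hC : C.PosDef) (hdiag : C.IsDiag)
    (T : Digraph V) (hT : LyapunovModel.IsPolytree T) :
    LyapunovModel.StructurallyIdentifiable C (LyapunovModel.dags V) T ∧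
      ∀ i j : V, ¬ LyapunovModel.IsSuperCovered C T i j :=
  mainTheorem9_general C hC hdiag T hT.1 fun _ _ =>
    hT.insert_neighbors_ne (by simpa using hV)
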